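/- A convex system in $\mathbb{R}^d$ is a finite family $K_1,\dots,K_n$ of pairwise disjoint, compact, strictly convex subsets of $\mathbb{R}^d$ with nonempty interior, where $n\ge 2$ and $d\ge 2$. A line $L$ is called ordinary for the system if $L\cap\bigcup_{i=1}^n K_i$ consists of exactly two points. Theorem. For every natural number $n$, there is a convex system $K_1,\dots,K_n$ of $n$ sets in the plane $\mathbb{R}^2$ with no ordinary line if and only if $n>3$. -/

import Mathlib

/-- A family `K₁, …, Kₙ` of sets in `ℝᵈ` is a *convex system* if `n ≥ 2`, `d ≥ 2`, and the `Kᵢ` are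
pairwise disjoint, compact, strictly convex and have nonempty interior. -/
structure IsConvexSystem {d n : ℕ} (K : Fin n → Set (EuclideanSpace ℝ (Fin d))) : Prop where
  two_le_card : 2 ≤ n
  two_le_dim : 2 ≤ d
  disjoint : ∀ i j, i ≠ j → Disjoint (K i) (K j)
  isCompact : ∀ i, IsCompact (K i)
  strictConvex : ∀ i, StrictConvex ℝ (K i)
  interior_nonempty : ∀ i, (interior (K i)).Nonempty

/-- A line in `ℝᵈ`: a one-dimensional affine subspace. -/
def IsLine {d : ℕ} (L : AffineSubspace ℝ (EuclideanSpace ℝ (Fin d))) : Prop :=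
  Module.finrank ℝ L.direction = 1

/-- The line `L` is *ordinary* for the family `K` if it meets the union of the `Kᵢ` in exactly two
points. -/
def IsOrdinaryLine {d n : ℕ} (K : Fin n → Set (EuclideanSpace ℝ (Fin d)))
    (L : AffineSubspace ℝ (EuclideanSpace ℝ (Fin d))) : Prop :=
  IsLine L ∧ ((L : Set (EuclideanSpace ℝ (Fin d))) ∩ ⋃ i, K i).ncard = 2

/-! For `n > 3` take two unit discs centred at `(±7/5, 0)`, two discs of radius `9/20` centred at
`(0, ±11/20)`, and the remaining `n - 4` as tiny discs in the gap in the middle. A line through the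
interior of a disc meets it in infinitely many points, so an ordinary line would avoid all
interiors. It cannot pass between the unit discs, because the pair in the middle blocks it
(`far_line_of_misses_discs`). Passing outside both, it either touches at most one unit disc, in a
single point, or is `y = ±1`, which touches three discs.

For `n ≤ 3` a common tangent is ordinary. Two bodies have a separating tangent. For three,
continuity of the support functions gives a direction in which the two largest values agree
(`exists_ordinary_of_three`); the supporting line there is ordinary unless it touches all three
bodies, say in the order `A`, `B`, `C`. In that case consider the tangent separating `A` from `B`,
the tangent separating `B` from `C`, and the second outer tangent of `A` and `C`. If none is
ordinary, the first meets `C` in some `q`, the second meets `A` in some `p`, and the third meets `B`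
in some `z`. The two separating tangents cross below the supporting line, and with it they bound a
triangle containing `z`. This triangle lies in the convex hull of `p`, `q` and the contact points of
`A` and `C`, so `z` can hardly reach the boundary of a half-plane containing `A` and `C`;
`middle_point_lt` excludes the equality cases. -/

theorem EuclideanSpace.mem_closedBall_fin_two {m z : EuclideanSpace ℝ (Fin 2)} {r : ℝ} (hr : 0 ≤ r) :
    z ∈ Metric.closedBall m r ↔ (z 0 - m 0) ^ 2 + (z 1 - m 1) ^ 2 ≤ r ^ 2 := by
  rw [Metric.mem_closedBall, EuclideanSpace.dist_eq, Real.sqrt_le_left hr]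
  simp [Fin.sum_univ_two, Real.dist_eq, sq_abs]

theorem EuclideanSpace.ext_fin_two {y z : EuclideanSpace ℝ (Fin 2)} (h0 : y 0 = z 0)
    (h1 : y 1 = z 1) : y = z := by
  ext i
  fin_cases i
  · exact h0
  · exact h1

/-! ### Discs without an ordinary line, for `n > 3`. -/

/-- First coordinates of the centres of the discs in a system without ordinary lines. -/
noncomputable def discX (n : ℕ) : ℕ → ℝ
  | 0 => -7 / 5
  | 1 => 7 / 5
  | 2 => 0
  | 3 => 0
  | i + 4 => (i + 1) / (10 * n)

/-- Second coordinates of the centres of the discs in a system without ordinary lines. -/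
noncomputable def discY : ℕ → ℝ
  | 2 => 11 / 20
  | 3 => -11 / 20
  | _ => 0

/-- Radii of the discs in a system without ordinary lines. -/
noncomputable def discR (n : ℕ) : ℕ → ℝ
  | 0 => 1
  | 1 => 1
  | 2 => 9 / 20
  | 3 => 9 / 20
  | _ => 1 / (30 * n)

/-- Small discs occur only when `n > 4`, so these bounds keep them in the gap between the four large
discs, uniformly in `n`. -/
theorem small_disc_bounds {n i : ℕ} (hi : i + 4 < n) :
    0 < ((i : ℝ) + 1) / (10 * n) ∧ ((i : ℝ) + 1) / (10 * n) ≤ 1 / 10 ∧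
      0 < 1 / (30 * (n : ℝ)) ∧ 1 / (30 * (n : ℝ)) ≤ 1 / 120 := by
  have hn : (i : ℝ) + 4 < n := by exact_mod_cast hi
  have hi0 : (0 : ℝ) ≤ i := Nat.cast_nonneg i
  have hn0 : (0 : ℝ) < n := by linarith
  refine ⟨by positivity, ?_, by positivity, ?_⟩
  · rw [div_le_div_iff₀ (by positivity) (by norm_num)]; linarith
  · rw [div_le_div_iff₀ (by positivity) (by norm_num)]; linarith

theorem discR_pos {n i : ℕ} (hi : i < n) : 0 < discR n i := by
  match i with
  | 0 => norm_num [discR]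
  | 1 => norm_num [discR]
  | 2 => norm_num [discR]
  | 3 => norm_num [discR]
  | i + 4 => exact (small_disc_bounds hi).2.2.1

theorem disc_separated {n i j : ℕ} (hij : i < j) (hj : j < n) :
    (discR n i + discR n j) ^ 2 <
      (discX n i - discX n j) ^ 2 + (discY i - discY j) ^ 2 := by
  match j with
  | 0 => omega
  | 1 =>
    obtain rfl : i = 0 := by omega
    norm_num [discX, discY, discR]
  | 2 => interval_cases i <;> norm_num [discX, discY, discR]
  | 3 => interval_cases i <;> norm_num [discX, discY, discR]
  | j + 4 =>
    obtain ⟨hx, hx', hr, hr'⟩ := small_disc_bounds hj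
    match i with
    | 0 => simp only [discX, discY, discR]; nlinarith
    | 1 => simp only [discX, discY, discR]; nlinarith
    | 2 => simp only [discX, discY, discR]; nlinarith
    | 3 => simp only [discX, discY, discR]; nlinarith
    | i + 4 =>
      have hij' : (i : ℝ) + 1 ≤ j := by exact_mod_cast (by omega : i + 1 ≤ j)
      have hn : (0 : ℝ) < n := by exact_mod_cast (by omega : 0 < n)
      -- Consecutive small centres are `1 / (10 * n)` apart, which is three radii; disjointness
      -- needs more than two.
      have h : ((j : ℝ) + 1) / (10 * n) - (i + 1) / (10 * n) ≥ 3 * (1 / (30 * n)) := by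
        have : ((j : ℝ) + 1) / (10 * n) - (i + 1) / (10 * n) - 3 * (1 / (30 * n))
            = (j - (i + 1)) / (10 * n) := by
          field_simp; ring
        have h2 : 0 ≤ ((j : ℝ) - (i + 1)) / (10 * n) := div_nonneg (by linarith) (by positivity)
        linarith
      simp only [discX, discY, discR]
      nlinarith

/-- A system of `n ≥ 4` discs without ordinary lines. -/
noncomputable def discSystem (n : ℕ) (i : Fin n) : Set (EuclideanSpace ℝ (Fin 2)) :=
  Metric.closedBall !₂[discX n i, discY i] (discR n i)

theorem mem_discSystem {n : ℕ} {i : Fin n} {z : EuclideanSpace ℝ (Fin 2)} :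
    z ∈ discSystem n i ↔
      (z 0 - discX n i) ^ 2 + (z 1 - discY i) ^ 2 ≤ discR n i ^ 2 := by
  rw [discSystem, EuclideanSpace.mem_closedBall_fin_two (discR_pos i.2).le]
  simp

theorem isConvexSystem_discSystem {n : ℕ} (hn : 2 ≤ n) : IsConvexSystem (discSystem n) where
  two_le_card := hn
  two_le_dim := le_rfl
  disjoint := by
    have key : ∀ i j : Fin n, i < j → Disjoint (discSystem n i) (discSystem n j) := by
      intro i j hij
      refine Metric.closedBall_disjoint_closedBall ?_
      have h := disc_separated (n := n) (show (i : ℕ) < j from hij) j.2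
      rw [EuclideanSpace.dist_eq]
      refine Real.lt_sqrt_of_sq_lt ?_
      simpa [Fin.sum_univ_two, Real.dist_eq, sq_abs] using h
    intro i j hij
    rcases lt_or_gt_of_ne hij with h | h
    · exact key i j h
    · exact (key j i h).symm
  isCompact _ := isCompact_closedBall _ _
  strictConvex _ := strictConvex_closedBall ℝ _ _
  interior_nonempty i :=
    ⟨_, Metric.ball_subset_interior_closedBall (Metric.mem_ball_self (discR_pos i.2))⟩

/-- A line meeting the interior of a disc meets the disc in more than two points. -/
theorem le_abs_of_inter_disc_subset_pair {s t : EuclideanSpace ℝ (Fin 2)} {p q c a b r : ℝ}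
    (hpq : p ^ 2 + q ^ 2 = 1)
    (h : ∀ z : EuclideanSpace ℝ (Fin 2), p * z 0 + q * z 1 = c →
      (z 0 - a) ^ 2 + (z 1 - b) ^ 2 ≤ r ^ 2 → z = s ∨ z = t) :
    r ≤ |c - (p * a + q * b)| := by
  by_contra! hlt
  set d := c - (p * a + q * b) with hd
  -- The foot of the perpendicular from the centre and the points at distance `e` from it on either
  -- side all lie in the disc, since `d ^ 2 + e ^ 2 ≤ (|d| + e) ^ 2 = r ^ 2`. Three distinct points
  -- cannot all lie in `{s, t}`.
  set e := r - |d| with he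
  have he0 : 0 < e := by linarith
  have hd0 : 0 ≤ |d| := abs_nonneg d
  have key : ∀ τ : ℝ, τ ^ 2 ≤ e ^ 2 →
      (!₂[a + d * p - τ * q, b + d * q + τ * p] : EuclideanSpace ℝ (Fin 2)) = s ∨
      (!₂[a + d * p - τ * q, b + d * q + τ * p] : EuclideanSpace ℝ (Fin 2)) = t := by
    intro τ hτ
    apply h
    · simp only [Matrix.cons_val_zero, Matrix.cons_val_one]
      linear_combination d * hpq + hd
    · simp only [Matrix.cons_val_zero, Matrix.cons_val_one]
      have : (a + d * p - τ * q - a) ^ 2 + (b + d * q + τ * p - b) ^ 2 = d ^ 2 + τ ^ 2 := by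
        linear_combination (d ^ 2 + τ ^ 2) * hpq
      rw [this, ← sq_abs d]
      nlinarith
  have inj : ∀ τ σ : ℝ,
      (!₂[a + d * p - τ * q, b + d * q + τ * p] : EuclideanSpace ℝ (Fin 2)) =
        !₂[a + d * p - σ * q, b + d * q + σ * p] → τ = σ := by
    intro τ σ hτσ
    have h0 := congrArg (fun z : EuclideanSpace ℝ (Fin 2) => z 0) hτσ
    have h1 := congrArg (fun z : EuclideanSpace ℝ (Fin 2) => z 1) hτσ
    simp only [Matrix.cons_val_zero, Matrix.cons_val_one] at h0 h1
    linear_combination (-q) * h0 + p * h1 - (τ - σ) * hpq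
  have h1 := key 0 (by simpa using sq_nonneg e)
  have h2 := key e le_rfl
  have h3 := key (-e) (by simp)
  have n12 := fun hh => he0.ne (inj _ _ hh)
  have n13 := fun hh => (neg_neg_of_pos he0).ne' (inj _ _ hh)
  have n23 := fun hh => (neg_lt_self he0).ne' (inj _ _ hh)
  rcases h1 with h1 | h1 <;> rcases h2 with h2 | h2 <;> rcases h3 with h3 | h3
  · exact n12 (h1.trans h2.symm)
  · exact n12 (h1.trans h2.symm)
  · exact n13 (h1.trans h3.symm)
  · exact n23 (h2.trans h3.symm)
  · exact n23 (h2.trans h3.symm)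
  · exact n13 (h1.trans h3.symm)
  · exact n12 (h1.trans h2.symm)
  · exact n12 (h1.trans h2.symm)

/-- For two discs of radius `r` placed symmetrically about the origin, the alternatives say that a
line missing both interiors has the discs on the same side or separates them. -/
theorem abs_sub_abs_cases {c x r : ℝ} (h1 : r ≤ |c - x|) (h2 : r ≤ |c + x|) :
    r + |x| ≤ |c| ∨ r + |c| ≤ |x| := by
  grind

theorem far_line_of_misses_discs {p q c : ℝ} (hpq : p ^ 2 + q ^ 2 = 1)
    (h0 : 1 ≤ |c + 7 / 5 * p|) (h1 : 1 ≤ |c - 7 / 5 * p|)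
    (h2 : 9 / 20 ≤ |c - 11 / 20 * q|) (h3 : 9 / 20 ≤ |c + 11 / 20 * q|) :
    1 + 7 / 5 * |p| ≤ |c| := by
  have hp := abs_nonneg p
  have hq := abs_nonneg q
  have hc := abs_nonneg c
  have hpq' : |p| ^ 2 + |q| ^ 2 = 1 := by rw [sq_abs, sq_abs, hpq]
  have e1 : |7 / 5 * p| = 7 / 5 * |p| := by rw [abs_mul]; norm_num
  have e2 : |11 / 20 * q| = 11 / 20 * |q| := by rw [abs_mul]; norm_num
  have h01 := abs_sub_abs_cases h1 h0
  have h23 := abs_sub_abs_cases h2 h3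
  rw [e1] at h01
  rw [e2] at h23
  rcases h01 with h | h
  · exact h
  · exfalso
    -- A line between the unit discs is steep and near the origin: `|p| ≥ 5/7` gives `|q| ≤ 7/10`,
    -- and `|c| ≤ 7/5 - 1 = 2/5`. As `2/5 < 9/20` and `11/20 * 7/10 < 9/20`, it neither passes
    -- outside the two middle discs nor separates them.
    have hp1 : |p| ≤ 1 := by nlinarith
    have hq1 : |q| ≤ 7 / 10 := by nlinarith
    rcases h23 with h' | h' <;> linarith

/-- The distance from the centre of a disc to a line meeting the disc is at most the radius, and
in case of equality the common point is determined. -/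
theorem line_meets_disc {p q c a b r x y : ℝ} (hpq : p ^ 2 + q ^ 2 = 1)
    (hl : p * x + q * y = c) (hd : (x - a) ^ 2 + (y - b) ^ 2 ≤ r ^ 2) :
    (c - (p * a + q * b)) ^ 2 + (q * (x - a) - p * (y - b)) ^ 2 ≤ r ^ 2 := by
  have : (c - (p * a + q * b)) ^ 2 + (q * (x - a) - p * (y - b)) ^ 2
      = (x - a) ^ 2 + (y - b) ^ 2 := by
    rw [← hl]
    linear_combination ((x - a) ^ 2 + (y - b) ^ 2) * hpq
  rwa [this]

/-- At tangency the normal component already uses up all of `r ^ 2` in `line_meets_disc`, so both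
tangential components vanish. -/
theorem eq_of_tangent_disc {p q c a b r : ℝ} {s t : EuclideanSpace ℝ (Fin 2)}
    (hpq : p ^ 2 + q ^ 2 = 1)
    (hs : p * s 0 + q * s 1 = c) (ht : p * t 0 + q * t 1 = c)
    (hds : (s 0 - a) ^ 2 + (s 1 - b) ^ 2 ≤ r ^ 2)
    (hdt : (t 0 - a) ^ 2 + (t 1 - b) ^ 2 ≤ r ^ 2)
    (hr : r ^ 2 ≤ (c - (p * a + q * b)) ^ 2) : s = t := by
  have h1 := line_meets_disc hpq hs hds
  have h2 := line_meets_disc hpq ht hdt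
  have e1 : q * (s 0 - a) - p * (s 1 - b) = 0 := by
    apply pow_eq_zero_iff (two_ne_zero) |>.1; nlinarith
  have e2 : q * (t 0 - a) - p * (t 1 - b) = 0 := by
    apply pow_eq_zero_iff (two_ne_zero) |>.1; nlinarith
  apply EuclideanSpace.ext_fin_two
  · linear_combination (-(s 0 - t 0)) * hpq + p * (hs - ht) + q * (e1 - e2)
  · linear_combination (-(s 1 - t 1)) * hpq + q * (hs - ht) - p * (e1 - e2)

/-- A line at distance at least `1 + 7/5 * |p|` from the origin can only touch the two unit
discs, unless it is horizontal. -/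
theorem disc_index_of_far_line {n : ℕ} {i : ℕ} (hi : i < n) {p q c x y : ℝ}
    (hpq : p ^ 2 + q ^ 2 = 1) (hp : p ≠ 0) (hc : 1 + 7 / 5 * |p| ≤ |c|)
    (hl : p * x + q * y = c)
    (hd : (x - discX n i) ^ 2 + (y - discY i) ^ 2 ≤ discR n i ^ 2) :
    i = 0 ∧ 1 ≤ (c + 7 / 5 * p) ^ 2 ∧ c * p < 0 ∨
      i = 1 ∧ 1 ≤ (c - 7 / 5 * p) ^ 2 ∧ 0 < c * p := by
  have h := line_meets_disc hpq hl hd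
  have hpos : 0 < |p| := abs_pos.2 hp
  have hq : |q| ≤ 1 := by rw [← sq_le_one_iff_abs_le_one]; nlinarith
  have hle : |c - (p * discX n i + q * discY i)| ≤ discR n i := by
    apply abs_le_of_sq_le_sq _ (discR_pos hi).le
    nlinarith [sq_nonneg (q * (x - discX n i) - p * (y - discY i))]
  clear h hd hl
  have hp1 : |p| ≤ 1 := by rw [← sq_le_one_iff_abs_le_one]; nlinarith
  rw [abs_le] at hle hq hp1
  have hc' : 1 + 7 / 5 * |p| ≤ c ∨ c ≤ -(1 + 7 / 5 * |p|) := by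
    rcases le_abs.1 hc with h | h
    · exact Or.inl h
    · exact Or.inr (by linarith)
  match i with
  | 0 =>
    left
    simp only [discX, discY, discR] at hle
    refine ⟨rfl, ?_, ?_⟩
    · rw [one_le_sq_iff_one_le_abs]; grind
    · rcases lt_or_gt_of_ne hp with h | h
      · rw [abs_of_neg h] at hc'
        rcases hc' with h' | h' <;> nlinarith
      · rw [abs_of_pos h] at hc'
        rcases hc' with h' | h' <;> nlinarith
  | 1 =>
    right
    simp only [discX, discY, discR] at hle
    refine ⟨rfl, ?_, ?_⟩
    · rw [one_le_sq_iff_one_le_abs]; grind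
    · rcases lt_or_gt_of_ne hp with h | h
      · rw [abs_of_neg h] at hc'
        rcases hc' with h' | h' <;> nlinarith
      · rw [abs_of_pos h] at hc'
        rcases hc' with h' | h' <;> nlinarith
  | 2 =>
    exfalso
    simp only [discX, discY, discR] at hle
    rcases hc' with h' | h' <;> linarith
  | 3 =>
    exfalso
    simp only [discX, discY, discR] at hle
    rcases hc' with h' | h' <;> linarith
  | i + 4 =>
    exfalso
    obtain ⟨hx, hx', hr, hr'⟩ := small_disc_bounds hi
    simp only [discX, discY, discR] at hle
    rcases hc' with h' | h' <;> nlinarith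

/-- A horizontal line at distance at least `1` from the origin can only meet the system at
height `1` or `-1`. -/
theorem eq_one_or_neg_one_of_far_horizontal {n : ℕ} {i : ℕ} (hi : i < n) {q c x y : ℝ}
    (hq : q ^ 2 = 1) (hc : 1 ≤ |c|) (hl : q * y = c)
    (hd : (x - discX n i) ^ 2 + (y - discY i) ^ 2 ≤ discR n i ^ 2) : y = 1 ∨ y = -1 := by
  have hcy : 1 ≤ y ^ 2 := by
    rw [← one_le_sq_iff_one_le_abs] at hc
    rw [← hl, mul_pow, hq] at hc
    linarith
  have hy : |y - discY i| ≤ discR n i := by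
    apply abs_le_of_sq_le_sq _ (discR_pos hi).le
    nlinarith [sq_nonneg (x - discX n i)]
  rw [abs_le] at hy
  rw [← sq_eq_one_iff]
  match i with
  | 0 => simp only [discY, discR] at hy; nlinarith
  | 1 => simp only [discY, discR] at hy; nlinarith
  | 2 => simp only [discY, discR] at hy; nlinarith
  | 3 => simp only [discY, discR] at hy; nlinarith
  | i + 4 =>
    obtain ⟨hx, hx', hr, hr'⟩ := small_disc_bounds hi
    simp only [discY, discR] at hy
    nlinarith

theorem not_isOrdinaryLine_discSystem {n : ℕ} (hn : 3 < n)
    (L : AffineSubspace ℝ (EuclideanSpace ℝ (Fin 2))) : ¬ IsOrdinaryLine (discSystem n) L := by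
  rintro ⟨-, hL⟩
  obtain ⟨s, t, hst, hU⟩ := Set.ncard_eq_two.1 hL
  have hs : s ∈ (L : Set (EuclideanSpace ℝ (Fin 2))) ∩ ⋃ i, discSystem n i := by rw [hU]; simp
  have ht : t ∈ (L : Set (EuclideanSpace ℝ (Fin 2))) ∩ ⋃ i, discSystem n i := by rw [hU]; simp
  obtain ⟨hsL, hs⟩ := hs
  obtain ⟨htL, ht⟩ := ht
  obtain ⟨i, hi⟩ := Set.mem_iUnion.1 hs
  obtain ⟨j, hj⟩ := Set.mem_iUnion.1 ht
  rw [mem_discSystem] at hi hj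
  set l := √((t 0 - s 0) ^ 2 + (t 1 - s 1) ^ 2) with hl
  have hsum : 0 < (t 0 - s 0) ^ 2 + (t 1 - s 1) ^ 2 := by
    by_contra! h
    apply hst
    apply EuclideanSpace.ext_fin_two
    · nlinarith [sq_nonneg (t 0 - s 0), sq_nonneg (t 1 - s 1)]
    · nlinarith [sq_nonneg (t 0 - s 0), sq_nonneg (t 1 - s 1)]
  have hl0 : 0 < l := Real.sqrt_pos.2 hsum
  have hl2 : l ^ 2 = (t 0 - s 0) ^ 2 + (t 1 - s 1) ^ 2 := Real.sq_sqrt hsum.le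
  -- `(p, q)` is the unit normal of the line through `s` and `t`.
  obtain ⟨p, hp⟩ : ∃ p, p = -(t 1 - s 1) / l := ⟨_, rfl⟩
  obtain ⟨q, hq⟩ : ∃ q, q = (t 0 - s 0) / l := ⟨_, rfl⟩
  have hp' : p * l = -(t 1 - s 1) := by rw [hp]; field_simp
  have hq' : q * l = t 0 - s 0 := by rw [hq]; field_simp
  have hpq : p ^ 2 + q ^ 2 = 1 := by
    have : (p ^ 2 + q ^ 2 - 1) * l ^ 2 = 0 := by
      linear_combination (p * l - (t 1 - s 1)) * hp' + (q * l + (t 0 - s 0)) * hq' - hl2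
    have := (mul_eq_zero.1 this).resolve_right (by positivity)
    linarith
  obtain ⟨c, hc⟩ : ∃ c, c = p * s 0 + q * s 1 := ⟨_, rfl⟩
  have hct : p * t 0 + q * t 1 = c := by
    rw [hc]
    linear_combination q * hp' - p * hq'
  have hmem : ∀ z : EuclideanSpace ℝ (Fin 2), p * z 0 + q * z 1 = c → z ∈ L := by
    intro z hz
    have : z = AffineMap.lineMap s t ((q * (z 0 - s 0) - p * (z 1 - s 1)) / l) := by
      apply EuclideanSpace.ext_fin_two
      · simp only [AffineMap.lineMap_apply, vsub_eq_sub, vadd_eq_add, PiLp.add_apply,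
          PiLp.smul_apply, PiLp.sub_apply, smul_eq_mul]
        rw [← hq']
        field_simp
        linear_combination (-(z 0 - s 0)) * hpq + p * (hz + hc)
      · simp only [AffineMap.lineMap_apply, vsub_eq_sub, vadd_eq_add, PiLp.add_apply,
          PiLp.smul_apply, PiLp.sub_apply, smul_eq_mul]
        rw [show t 1 - s 1 = -(p * l) by linarith]
        field_simp
        linear_combination (-(z 1 - s 1)) * hpq + q * (hz + hc)
    rw [this]
    exact AffineMap.lineMap_mem _ hsL htL
  have honly : ∀ (k : ℕ) (hk : k < n) (z : EuclideanSpace ℝ (Fin 2)),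
      p * z 0 + q * z 1 = c → (z 0 - discX n k) ^ 2 + (z 1 - discY k) ^ 2 ≤ discR n k ^ 2 →
      z = s ∨ z = t := by
    intro k hk z hz hz'
    have : z ∈ (L : Set (EuclideanSpace ℝ (Fin 2))) ∩ ⋃ i, discSystem n i :=
      ⟨hmem z hz, Set.mem_iUnion.2 ⟨⟨k, hk⟩, mem_discSystem.2 hz'⟩⟩
    rw [hU] at this
    simpa using this
  have hfar : 1 + 7 / 5 * |p| ≤ |c| := by
    have h0 := le_abs_of_inter_disc_subset_pair hpq (honly 0 (by omega))
    have h1 := le_abs_of_inter_disc_subset_pair hpq (honly 1 (by omega))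
    have h2 := le_abs_of_inter_disc_subset_pair hpq (honly 2 (by omega))
    have h3 := le_abs_of_inter_disc_subset_pair hpq (honly 3 (by omega))
    simp only [discX, discY, discR] at h0 h1 h2 h3
    apply far_line_of_misses_discs hpq
    · convert h0 using 2; ring
    · convert h1 using 2; ring
    · convert h2 using 2; ring
    · convert h3 using 2; ring
  by_cases hp0 : p = 0
  · subst hp0
    simp only [abs_zero, mul_zero, add_zero, zero_mul, zero_add, ne_eq, OfNat.ofNat_ne_zero,
      not_false_eq_true, zero_pow] at *
    have hy := eq_one_or_neg_one_of_far_horizontal i.2 hpq hfar hc.symm hi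
    -- These are the abscissas at which the line `y = ±1` touches both unit discs and one of the
    -- middle discs: three values, but only two points are available.
    have key : ∀ x : ℝ, x = -7 / 5 ∨ x = 7 / 5 ∨ x = 0 → x = s 0 ∨ x = t 0 := by
      intro x hx
      have : !₂[x, s 1] = s ∨ !₂[x, s 1] = t := by
        rcases hx with h | h | h
        · refine honly 0 (by omega) _ (by simp [hc]) ?_
          rcases hy with h' | h' <;> norm_num [discX, discY, discR, h, h']
        · refine honly 1 (by omega) _ (by simp [hc]) ?_
          rcases hy with h' | h' <;> norm_num [discX, discY, discR, h, h']
        · rcases hy with h' | h'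
          · refine honly 2 (by omega) _ (by simp [hc]) ?_
            norm_num [discX, discY, discR, h, h']
          · refine honly 3 (by omega) _ (by simp [hc]) ?_
            norm_num [discX, discY, discR, h, h']
      rcases this with h | h
      · left; rw [← h]; simp
      · right; rw [← h]; simp
    have k1 := key (-7 / 5) (by simp)
    have k2 := key (7 / 5) (by simp)
    have k3 := key 0 (by simp)
    rcases k1 with k1 | k1 <;> rcases k2 with k2 | k2 <;> rcases k3 with k3 | k3 <;> linarith
  · apply hst
    -- The sign of `c * p` decides which unit disc can be touched, so `s` and `t` lie on the same
    -- one and are the same point of tangency.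
    rcases disc_index_of_far_line i.2 hpq hp0 hfar hc.symm hi with ⟨hi', h1, h2⟩ | ⟨hi', h1, h2⟩ <;>
    rcases disc_index_of_far_line j.2 hpq hp0 hfar hct hj with ⟨hj', h3, h4⟩ | ⟨hj', h3, h4⟩
    · rw [hi'] at hi
      rw [hj'] at hj
      refine eq_of_tangent_disc hpq hc.symm hct hi hj ?_
      simp only [discX, discY, discR]
      convert h1 using 1 <;> ring
    · linarith
    · linarith
    · rw [hi'] at hi
      rw [hj'] at hj
      refine eq_of_tangent_disc hpq hc.symm hct hi hj ?_
      simp only [discX, discY, discR]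
      convert h1 using 1 <;> ring

/-! ### Directions, supporting lines and points of contact. -/

/-- The linear functional on the plane given by the unit vector at angle `θ`. -/
noncomputable def dirProj (θ : ℝ) (z : EuclideanSpace ℝ (Fin 2)) : ℝ :=
  Real.cos θ * z 0 + Real.sin θ * z 1

theorem dirProj_add_pi (θ : ℝ) (z : EuclideanSpace ℝ (Fin 2)) :
    dirProj (θ + Real.pi) z = -dirProj θ z := by
  simp [dirProj]; ring

theorem continuous_dirProj :
    Continuous fun x : ℝ × EuclideanSpace ℝ (Fin 2) => dirProj x.1 x.2 := by
  unfold dirProj; fun_prop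

/-- The functional at angle `η` in the orthonormal coordinates attached to the angle `θ`. -/
theorem dirProj_rotate (θ η : ℝ) (z : EuclideanSpace ℝ (Fin 2)) :
    dirProj η z =
      Real.sin (η - θ) * dirProj (θ + Real.pi / 2) z + Real.cos (η - θ) * dirProj θ z := by
  simp only [dirProj, Real.sin_sub, Real.cos_sub, Real.cos_add_pi_div_two,
    Real.sin_add_pi_div_two]
  have h := Real.sin_sq_add_cos_sq θ
  linear_combination (-(Real.cos η * z 0 + Real.sin η * z 1)) * h

theorem eq_of_dirProj_eq {θ : ℝ} {y z : EuclideanSpace ℝ (Fin 2)}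
    (h1 : dirProj (θ + Real.pi / 2) y = dirProj (θ + Real.pi / 2) z)
    (h2 : dirProj θ y = dirProj θ z) : y = z := by
  have h := fun η => (dirProj_rotate θ η y).trans ((by rw [h1, h2]) :
    _ = Real.sin (η - θ) * dirProj (θ + Real.pi / 2) z + Real.cos (η - θ) * dirProj θ z)
  have h' := fun η => (h η).trans (dirProj_rotate θ η z).symm
  apply EuclideanSpace.ext_fin_two
  · simpa [dirProj] using h' 0
  · simpa [dirProj] using h' (Real.pi / 2)

/-- A compact strictly convex subset of the plane with nonempty interior. -/
structure IsConvexBody (K : Set (EuclideanSpace ℝ (Fin 2))) : Prop where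
  isCompact : IsCompact K
  strictConvex : StrictConvex ℝ K
  interior_nonempty : (interior K).Nonempty

theorem dirProj_lt_of_mem_interior {K : Set (EuclideanSpace ℝ (Fin 2))} {θ c : ℝ}
    (h : ∀ z ∈ K, dirProj θ z ≤ c) {z : EuclideanSpace ℝ (Fin 2)} (hz : z ∈ interior K) :
    dirProj θ z < c := by
  let w : EuclideanSpace ℝ (Fin 2) := !₂[Real.cos θ, Real.sin θ]
  have hcont : Continuous fun t : ℝ => z + t • w := by fun_prop
  have hn : (fun t : ℝ => z + t • w) ⁻¹' interior K ∈ nhds (0 : ℝ) :=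
    hcont.continuousAt.preimage_mem_nhds (isOpen_interior.mem_nhds (by simpa using hz))
  obtain ⟨ε, hε, hball⟩ := Metric.mem_nhds_iff.1 hn
  have hmem : z + (ε / 2) • w ∈ K := by
    apply interior_subset
    apply hball (a := ε / 2)
    rw [Metric.mem_ball, Real.dist_eq, sub_zero, abs_of_pos (by positivity)]
    linarith
  have h1 := h _ hmem
  have h2 : dirProj θ (z + (ε / 2) • w) = dirProj θ z + ε / 2 := by
    simp only [dirProj, w, PiLp.add_apply, PiLp.smul_apply, smul_eq_mul,
      Matrix.cons_val_zero, Matrix.cons_val_one]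
    linear_combination (ε / 2) * Real.sin_sq_add_cos_sq θ
  linarith

theorem lt_dirProj_of_mem_interior {K : Set (EuclideanSpace ℝ (Fin 2))} {θ c : ℝ}
    (h : ∀ z ∈ K, c ≤ dirProj θ z) {z : EuclideanSpace ℝ (Fin 2)} (hz : z ∈ interior K) :
    c < dirProj θ z := by
  have := dirProj_lt_of_mem_interior (K := K) (θ := θ + Real.pi) (c := -c)
    (fun z hz => by rw [dirProj_add_pi]; linarith [h z hz]) hz
  rw [dirProj_add_pi] at this
  linarith

/-- `K` lies on one side of the line `dirProj θ = c` and meets it. -/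
def TouchesLine (θ c : ℝ) (K : Set (EuclideanSpace ℝ (Fin 2))) : Prop :=
  ((∀ z ∈ K, dirProj θ z ≤ c) ∨ (∀ z ∈ K, c ≤ dirProj θ z)) ∧ ∃ z ∈ K, dirProj θ z = c

/-- The midpoint of two points of contact would be an interior point lying on a supporting line. -/
theorem TouchesLine.existsUnique {θ c : ℝ} {K : Set (EuclideanSpace ℝ (Fin 2))}
    (h : TouchesLine θ c K) (hK : StrictConvex ℝ K) :
    ∃ x ∈ K, dirProj θ x = c ∧ ∀ y ∈ K, dirProj θ y = c → y = x := by
  obtain ⟨hside, x, hx, hxc⟩ := h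
  refine ⟨x, hx, hxc, fun y hy hyc => ?_⟩
  by_contra hne
  have hmid : (1 / 2 : ℝ) • y + (1 / 2 : ℝ) • x ∈ interior K :=
    hK hy hx hne (by norm_num) (by norm_num) (by norm_num)
  have hval : dirProj θ ((1 / 2 : ℝ) • y + (1 / 2 : ℝ) • x) = c := by
    simp only [dirProj, PiLp.add_apply, PiLp.smul_apply, smul_eq_mul] at *
    linarith
  rcases hside with h | h
  · exact (dirProj_lt_of_mem_interior h hmid).ne hval
  · exact (lt_dirProj_of_mem_interior h hmid).ne' hval

/-- The source of every ordinary line found for two or three bodies; `C = ∅` covers the case of two.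
-/
theorem ncard_eq_two_of_touchesLine {θ c : ℝ} {A B C : Set (EuclideanSpace ℝ (Fin 2))}
    (hA : StrictConvex ℝ A) (hB : StrictConvex ℝ B) (hAB : Disjoint A B)
    (tA : TouchesLine θ c A) (tB : TouchesLine θ c B) (hC : ∀ z ∈ C, dirProj θ z ≠ c) :
    {z | dirProj θ z = c ∧ (z ∈ A ∨ z ∈ B ∨ z ∈ C)}.ncard = 2 := by
  obtain ⟨x, hx, hxc, hxu⟩ := tA.existsUnique hA
  obtain ⟨y, hy, hyc, hyu⟩ := tB.existsUnique hB
  rw [Set.ncard_eq_two]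
  refine ⟨x, y, fun h => Set.disjoint_left.1 hAB hx (h ▸ hy), ?_⟩
  ext z
  simp only [Set.mem_ofPred_eq, Set.mem_insert_iff, Set.mem_singleton_iff]
  constructor
  · rintro ⟨hz, h | h | h⟩
    · exact Or.inl (hxu z h hz)
    · exact Or.inr (hyu z h hz)
    · exact absurd hz (hC z h)
  · rintro (rfl | rfl)
    · exact ⟨hxc, Or.inl hx⟩
    · exact ⟨hyc, Or.inr (Or.inl hy)⟩

/-! ### Support functions and separation. -/

/-- The support function of `K` as a function of the angle. -/
noncomputable def angleSupport (K : Set (EuclideanSpace ℝ (Fin 2))) (θ : ℝ) : ℝ :=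
  sSup (dirProj θ '' K)

theorem continuous_angleSupport {K : Set (EuclideanSpace ℝ (Fin 2))} (hK : IsCompact K) :
    Continuous (angleSupport K) :=
  hK.continuous_sSup continuous_dirProj

theorem exists_dirProj_eq_angleSupport {K : Set (EuclideanSpace ℝ (Fin 2))} (hK : IsConvexBody K)
    (θ : ℝ) : ∃ z ∈ K, dirProj θ z = angleSupport K θ := by
  obtain ⟨z, hz, h⟩ := hK.isCompact.exists_sSup_image_eq (hK.interior_nonempty.mono interior_subset)
    (f := dirProj θ) (by unfold dirProj; fun_prop)
  exact ⟨z, hz, h.symm⟩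

theorem dirProj_le_angleSupport {K : Set (EuclideanSpace ℝ (Fin 2))} (hK : IsCompact K)
    (θ : ℝ) {z : EuclideanSpace ℝ (Fin 2)} (hz : z ∈ K) : dirProj θ z ≤ angleSupport K θ := by
  have hc : Continuous (dirProj θ) := by unfold dirProj; fun_prop
  exact le_csSup (hK.image hc).bddAbove (Set.mem_image_of_mem _ hz)

theorem neg_angleSupport_le_dirProj {K : Set (EuclideanSpace ℝ (Fin 2))} (hK : IsCompact K)
    (θ : ℝ) {z : EuclideanSpace ℝ (Fin 2)} (hz : z ∈ K) :
    -angleSupport K (θ + Real.pi) ≤ dirProj θ z := by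
  have := dirProj_le_angleSupport hK (θ + Real.pi) hz
  rw [dirProj_add_pi] at this
  linarith

theorem angleSupport_add_two_pi (K : Set (EuclideanSpace ℝ (Fin 2))) (θ : ℝ) :
    angleSupport K (θ + Real.pi + Real.pi) = angleSupport K θ := by
  have : dirProj (θ + Real.pi + Real.pi) = dirProj θ := by
    ext z; rw [dirProj_add_pi, dirProj_add_pi, neg_neg]
  rw [angleSupport, this, angleSupport]

theorem touchesLine_angleSupport {K : Set (EuclideanSpace ℝ (Fin 2))} (hK : IsConvexBody K)
    (θ : ℝ) : TouchesLine θ (angleSupport K θ) K :=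
  ⟨Or.inl fun _ hz => dirProj_le_angleSupport hK.isCompact θ hz,
    exists_dirProj_eq_angleSupport hK θ⟩

theorem exists_separating_angle {A B : Set (EuclideanSpace ℝ (Fin 2))} (hA : IsConvexBody A)
    (hB : IsConvexBody B) (hAB : Disjoint A B) :
    ∃ θ c : ℝ, (∀ z ∈ A, dirProj θ z < c) ∧ ∀ z ∈ B, c < dirProj θ z := by
  obtain ⟨f, u, v, h1, huv, h2⟩ := geometric_hahn_banach_compact_closed hA.strictConvex.convex
    hA.isCompact hB.strictConvex.convex hB.isCompact.isClosed hAB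
  have hf : ∀ z, f z = f (EuclideanSpace.single 0 1) * z 0 + f (EuclideanSpace.single 1 1) * z 1 := by
    intro z
    have : z = z 0 • EuclideanSpace.single 0 1 + z 1 • EuclideanSpace.single 1 1 := by
      apply EuclideanSpace.ext_fin_two <;> simp
    conv_lhs => rw [this]
    simp [mul_comm]
  -- The separating functional, read as a complex number, has the required angle as its argument.
  set ω : ℂ := ⟨f (EuclideanSpace.single 0 1), f (EuclideanSpace.single 1 1)⟩ with hω
  have hz : ∀ z, f z = ‖ω‖ * dirProj ω.arg z := by
    intro z
    have e1 := Complex.norm_mul_cos_arg ω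
    have e2 := Complex.norm_mul_sin_arg ω
    rw [hf z, dirProj, mul_add, ← mul_assoc, ← mul_assoc, e1, e2]
  obtain ⟨a, ha⟩ := hA.interior_nonempty.mono interior_subset
  obtain ⟨b, hb⟩ := hB.interior_nonempty.mono interior_subset
  have hpos : 0 < ‖ω‖ := by
    refine (norm_nonneg ω).lt_of_ne fun h => ?_
    have := h1 a ha
    have := h2 b hb
    simp only [hz, ← h, zero_mul] at *
    linarith
  refine ⟨ω.arg, u / ‖ω‖, fun z hzA => ?_, fun z hzB => ?_⟩
  · rw [lt_div_iff₀ hpos, mul_comm, ← hz]; exact h1 z hzA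
  · rw [div_lt_iff₀ hpos, mul_comm, ← hz]; exact huv.trans (h2 z hzB)

theorem exists_separating_angleSupport {A B : Set (EuclideanSpace ℝ (Fin 2))} (hA : IsConvexBody A)
    (hB : IsConvexBody B) (hAB : Disjoint A B) :
    ∃ θ, angleSupport A θ < -angleSupport B (θ + Real.pi) := by
  obtain ⟨θ, c, h1, h2⟩ := exists_separating_angle hA hB hAB
  obtain ⟨a, ha, ha'⟩ := exists_dirProj_eq_angleSupport hA θ
  obtain ⟨b, hb, hb'⟩ := exists_dirProj_eq_angleSupport hB (θ + Real.pi)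
  rw [dirProj_add_pi] at hb'
  exact ⟨θ, by linarith [h1 a ha, h2 b hb]⟩

theorem neg_angleSupport_lt {K : Set (EuclideanSpace ℝ (Fin 2))} (hK : IsConvexBody K) (θ : ℝ) :
    -angleSupport K (θ + Real.pi) < angleSupport K θ := by
  obtain ⟨z, hz⟩ := hK.interior_nonempty
  have h1 := neg_angleSupport_le_dirProj hK.isCompact θ (interior_subset hz)
  have h2 := dirProj_lt_of_mem_interior
    (fun z hz => dirProj_le_angleSupport hK.isCompact θ hz) hz
  linarith

/-! ### Common tangents of two disjoint bodies. -/

/-- Two disjoint bodies have a common tangent separating them. -/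
theorem exists_inner_tangent {A B : Set (EuclideanSpace ℝ (Fin 2))} (hA : IsConvexBody A)
    (hB : IsConvexBody B) (hAB : Disjoint A B) :
    ∃ θ c : ℝ, (∀ z ∈ A, dirProj θ z ≤ c) ∧ (∀ z ∈ B, c ≤ dirProj θ z) ∧
      (∃ z ∈ A, dirProj θ z = c) ∧ ∃ z ∈ B, dirProj θ z = c := by
  obtain ⟨θ₀, h₀⟩ := exists_separating_angleSupport hA hB hAB
  have hcA := continuous_angleSupport hA.isCompact
  have hcB := continuous_angleSupport hB.isCompact
  -- A zero of this function is a separating tangent. It is negative at `θ₀`; half a turn later it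
  -- is positive, because each body has positive width.
  have hg : Continuous fun θ => angleSupport A θ + angleSupport B (θ + Real.pi) := by fun_prop
  obtain ⟨θ, -, hθ⟩ := intermediate_value_Icc (a := θ₀) (b := θ₀ + Real.pi)
    (by linarith [Real.pi_pos]) hg.continuousOn (show (0 : ℝ) ∈ _ from ⟨by linarith, by
      simp only [angleSupport_add_two_pi]
      linarith [neg_angleSupport_lt hA θ₀, neg_angleSupport_lt hB θ₀]⟩)
  refine ⟨θ, angleSupport A θ, fun z hz => dirProj_le_angleSupport hA.isCompact θ hz,
    fun z hz => ?_, exists_dirProj_eq_angleSupport hA θ, ?_⟩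
  · have := neg_angleSupport_le_dirProj hB.isCompact θ hz
    simp only at hθ
    linarith
  · obtain ⟨b, hb, hb'⟩ := exists_dirProj_eq_angleSupport hB (θ + Real.pi)
    rw [dirProj_add_pi] at hb'
    simp only at hθ
    exact ⟨b, hb, by linarith⟩

/-- Two disjoint bodies have a second outer common tangent besides a given direction. -/
theorem exists_outer_tangent_ne {A B : Set (EuclideanSpace ℝ (Fin 2))} (hA : IsConvexBody A)
    (hB : IsConvexBody B) (hAB : Disjoint A B) (η : ℝ) :
    ∃ θ, angleSupport A θ = angleSupport B θ ∧ ¬ (Real.sin (θ - η) = 0 ∧ 0 ≤ Real.cos (θ - η)) := by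
  obtain ⟨θ₀, h₀⟩ := exists_separating_angleSupport hA hB hAB
  have hcA := continuous_angleSupport hA.isCompact
  have hcB := continuous_angleSupport hB.isCompact
  -- The difference is negative at `θ₀`, positive half a turn later and negative again after a full
  -- turn. Its zeros in the two open half-turns differ by less than `2π`, so they cannot both equal
  -- `η` modulo `2π`.
  have hg : Continuous fun θ => angleSupport A θ - angleSupport B θ := by fun_prop
  have hn : angleSupport A θ₀ - angleSupport B θ₀ < 0 := by
    linarith [neg_angleSupport_lt hB θ₀]
  have hp : 0 < angleSupport A (θ₀ + Real.pi) - angleSupport B (θ₀ + Real.pi) := by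
    linarith [neg_angleSupport_lt hA θ₀]
  have hn' : angleSupport A (θ₀ + Real.pi + Real.pi) - angleSupport B (θ₀ + Real.pi + Real.pi) < 0 := by
    simpa only [angleSupport_add_two_pi] using hn
  obtain ⟨θ₁, m₁, e₁⟩ := intermediate_value_Ioo (a := θ₀) (b := θ₀ + Real.pi)
    (by linarith [Real.pi_pos]) hg.continuousOn (show (0 : ℝ) ∈ _ from ⟨hn, hp⟩)
  obtain ⟨θ₂, m₂, e₂⟩ := intermediate_value_Ioo' (a := θ₀ + Real.pi) (b := θ₀ + Real.pi + Real.pi)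
    (by linarith [Real.pi_pos]) hg.continuousOn (show (0 : ℝ) ∈ _ from ⟨hn', hp⟩)
  by_contra! hcon
  obtain ⟨s₁, c₁⟩ := hcon θ₁ (by simpa [sub_eq_zero] using e₁)
  obtain ⟨s₂, c₂⟩ := hcon θ₂ (by simpa [sub_eq_zero] using e₂)
  have hone : ∀ x : ℝ, Real.sin x = 0 → 0 ≤ Real.cos x → Real.cos x = 1 := by
    intro x hs hc
    have := Real.sin_sq_add_cos_sq x
    rw [hs] at this
    nlinarith
  have hcos : Real.cos (θ₂ - θ₁) = 1 := by
    have : θ₂ - θ₁ = (θ₂ - η) - (θ₁ - η) := by ring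
    rw [this, Real.cos_sub, s₁, s₂, hone _ s₁ c₁, hone _ s₂ c₂]
    norm_num
  rw [Real.cos_eq_one_iff_of_lt_of_lt (by linarith [m₁.2, m₂.1, Real.pi_pos])
    (by linarith [m₁.1, m₂.2])] at hcos
  linarith [m₁.2, m₂.1]

/-! ### Three bodies on a common supporting line. -/

/-- The asymmetric part of `middle_point_lt`. -/
theorem middle_point_lt_aux {x₂ x₃ α β γ δ k l m bx bY cx cy px py qx qy zx zy : ℝ}
    (hf2 : α ≤ x₂) (hg2 : x₂ ≤ γ) (hg3 : γ ≤ x₃)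
    (hbY : bY < 0) (hfb : 0 < bx + β * bY - α) (hgb : bx + δ * bY - γ < 0)
    (hgc : 0 < cx + δ * cy - γ)
    (hfq : qx + β * qy = α) (hgq : 0 ≤ qx + δ * qy - γ) (hqy : qy ≤ 0)
    (hq : ¬ (qx = x₂ ∧ qy = 0))
    (hgp : px + δ * py = γ) (hfp : px + β * py - α ≤ 0)
    (hzy : zy ≤ 0) (hfz : 0 ≤ zx + β * zy - α) (hgz : zx + δ * zy - γ ≤ 0)
    (hzp : ¬ (zx = px ∧ zy = py)) (hzq : ¬ (zx = qx ∧ zy = qy)) (hz3 : ¬ (zx = x₃ ∧ zy = 0))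
    (hk3 : k * x₃ ≤ m) (hkp : k * px + l * py ≤ m) (hkq : k * qx + l * qy ≤ m)
    (hkc : k * cx + l * cy ≤ m) (hk : 0 < k ∨ k = 0 ∧ l < 0) :
    k * zx + l * zy < m := by
  -- If `α = γ`, both tangents cross the axis at `x₂`; the interior point of `B` then fixes their
  -- relative slope, which forces `q` to be the contact point of `B`.
  have hαγ : α < γ := by
    rcases (hf2.trans hg2).lt_or_eq with h | h
    · exact h
    · exfalso
      have h1 : 0 < δ - β := by nlinarith only [hfb, hgb, hbY, h]
      have h2 : 0 ≤ qy := by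
        by_contra! hneg
        nlinarith only [h, h1, hfq, hgq, hneg]
      replace h2 : qy = 0 := le_antisymm hqy h2
      exact hq ⟨by rw [h2] at hfq; linarith, h2⟩
  -- The two separating tangents cross below the axis, and `p` and `q` are no higher than the
  -- crossing, hence no higher than `z`.
  have hD : 0 < β - δ := by nlinarith only [hαγ, hfq, hgq, hqy]
  have hqz : qy ≤ zy := by nlinarith only [hD, hfq, hgq, hfz, hgz]
  have hpz : py ≤ zy := by nlinarith only [hD, hgp, hfp, hfz, hgz]
  have hpy : py < 0 := by nlinarith only [hD, hgp, hfp, hαγ]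
  rcases hk with hk | ⟨rfl, hl⟩
  · have hR : k * zx + l * zy ≤ k * (γ - δ * zy) + l * zy := by nlinarith only [hk, hgz]
    rcases hzy.lt_or_eq with hzy' | hzy'
    · rcases hpz.lt_or_eq with hpz' | hpz'
      · refine hR.trans_lt ?_
        have e : (-py) * (k * (γ - δ * zy) + l * zy - m)
            = (zy - py) * (k * γ - m) + (-zy) * (k * px + l * py - m) := by
          rw [← hgp]; ring
        have hγ : k * γ - m ≤ 0 := by nlinarith only [hk, hg3, hk3]
        have t1 : (zy - py) * (k * γ - m) ≤ 0 := by nlinarith only [hpz', hγ]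
        have t2 : (-zy) * (k * px + l * py - m) ≤ 0 := by nlinarith only [hzy', hkp]
        -- Equality would make both ends of that segment extremal, so the bounding line would be `g
        -- = 0`, beyond which `C` has an interior point.
        by_contra! hcon
        have t3 : 0 ≤ (-py) * (k * (γ - δ * zy) + l * zy - m) := by
          apply mul_nonneg <;> linarith
        have u1 : k * γ - m = 0 := by
          have : (zy - py) * (k * γ - m) = 0 := by linarith
          exact (mul_eq_zero.1 this).resolve_left (by linarith)
        have u2 : k * px + l * py - m = 0 := by
          have : (-zy) * (k * px + l * py - m) = 0 := by linarith
          exact (mul_eq_zero.1 this).resolve_left (by linarith)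
        have u3 : l = k * δ := by
          have : (l - k * δ) * py = 0 := by
            linear_combination u2 - u1 - k * hgp
          have := (mul_eq_zero.1 this).resolve_right hpy.ne
          linarith
        rw [u3] at hkc
        nlinarith only [hk, hgc, hkc, u1]
      · exfalso
        apply hzp
        refine ⟨?_, hpz'.symm⟩
        rw [← hpz'] at hfz hgz
        linarith
    · subst hzy'
      have : zx < x₃ := by
        refine lt_of_le_of_ne (by linarith) fun h => hz3 ⟨h, rfl⟩
      nlinarith only [hk, this, hk3]
  · rcases hqz.lt_or_eq with hqz' | hqz'
    · nlinarith only [hl, hqz', hkq]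
    · exfalso
      apply hzq
      refine ⟨?_, hqz'.symm⟩
      rw [← hqz'] at hfz hgz
      linarith

/-- Suppose that `A`, `B`, `C` touch the `x`-axis from below at abscissas `x₁`, `x₂`, `x₃`, that the
line `f = 0` with `f = x + β y - α` separates `A` from `B` and meets `C` in `q`, and that the line
`g = 0` with `g = x + δ y - γ` separates `B` from `C` and meets `A` in `p`. Then a point `z` of `B`
lies strictly inside every half-plane `k x + l y ≤ m` containing `A` and `C`, apart from the one
bounded by the axis. Here `(ax, ay)`, `(bx, bY)`, `(cx, cy)` are interior points of `A`, `B`, `C`. -/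
theorem middle_point_lt {x₁ x₂ x₃ α β γ δ k l m ax ay bx bY cx cy px py qx qy zx zy : ℝ}
    (hf1 : x₁ ≤ α) (hf2 : α ≤ x₂) (hg2 : x₂ ≤ γ) (hg3 : γ ≤ x₃)
    (hbY : bY < 0) (hfb : 0 < bx + β * bY - α) (hgb : bx + δ * bY - γ < 0)
    (hfa : ax + β * ay - α < 0) (hgc : 0 < cx + δ * cy - γ)
    (hfq : qx + β * qy = α) (hgq : 0 ≤ qx + δ * qy - γ) (hqy : qy ≤ 0)
    (hq : ¬ (qx = x₂ ∧ qy = 0))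
    (hgp : px + δ * py = γ) (hfp : px + β * py - α ≤ 0) (hpy : py ≤ 0)
    (hp : ¬ (px = x₂ ∧ py = 0))
    (hzy : zy ≤ 0) (hfz : 0 ≤ zx + β * zy - α) (hgz : zx + δ * zy - γ ≤ 0)
    (hzp : ¬ (zx = px ∧ zy = py)) (hzq : ¬ (zx = qx ∧ zy = qy))
    (hz1 : ¬ (zx = x₁ ∧ zy = 0)) (hz3 : ¬ (zx = x₃ ∧ zy = 0))
    (hk1 : k * x₁ ≤ m) (hk3 : k * x₃ ≤ m)
    (hkp : k * px + l * py ≤ m) (hkq : k * qx + l * qy ≤ m)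
    (hka : k * ax + l * ay ≤ m) (hkc : k * cx + l * cy ≤ m) (hk : ¬ (k = 0 ∧ 0 ≤ l)) :
    k * zx + l * zy < m := by
  -- The reflection `x ↦ -x` exchanges the roles of `A` and `C` and reduces `k < 0` to `k > 0`.
  rcases lt_trichotomy k 0 with h | h | h
  · have := middle_point_lt_aux (x₂ := -x₂) (x₃ := -x₁) (α := -γ) (β := -δ) (γ := -α)
      (δ := -β) (k := -k) (l := l) (m := m) (bx := -bx) (bY := bY) (cx := -ax) (cy := ay)
      (px := -qx) (py := qy) (qx := -px) (qy := py) (zx := -zx) (zy := zy)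
      (by linarith) (by linarith) (by linarith) hbY (by linarith) (by linarith)
      (by linarith) (by linarith) (by linarith) hpy (by simpa using hp) (by linarith)
      (by linarith) hzy (by linarith) (by linarith) (by simpa using hzq) (by simpa using hzp)
      (by simpa using hz1) (by linarith) (by linarith) (by linarith) (by linarith)
      (Or.inl (by linarith))
    linarith
  · exact middle_point_lt_aux hf2 hg2 hg3 hbY hfb hgb hgc hfq hgq hqy hq hgp hfp hzy hfz
      hgz hzp hzq hz3 hk3 hkp hkq hkc (Or.inr ⟨h, not_le.1 fun hl => hk ⟨h, hl⟩⟩)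
  · exact middle_point_lt_aux hf2 hg2 hg3 hbY hfb hgb hgc hfq hgq hqy hq hgp hfp hzy hfz
      hgz hzp hzq hz3 hk3 hkp hkq hkc (Or.inl h)

/-- A tangent separating two bodies that touch a common line from below, in coordinates in which
the body on the left is on the left of the tangent and the tangent is not parallel to the line. -/
theorem exists_inner_tangent_normalized {θ h : ℝ} {A B : Set (EuclideanSpace ℝ (Fin 2))}
    {X Y : EuclideanSpace ℝ (Fin 2) → ℝ} (hX : X = dirProj (θ + Real.pi / 2))
    (hY : Y = fun z => dirProj θ z - h)
    (hA : IsConvexBody A) (hB : IsConvexBody B) (hAB : Disjoint A B)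
    (hAh : ∀ z ∈ A, Y z ≤ 0) (hBh : ∀ z ∈ B, Y z ≤ 0)
    {a b : EuclideanSpace ℝ (Fin 2)} (ha : a ∈ A) (hb : b ∈ B) (haY : Y a = 0) (hbY : Y b = 0)
    (hab : X a < X b) :
    ∃ η c α β : ℝ, TouchesLine η c A ∧ TouchesLine η c B ∧
      (∀ z ∈ A, X z + β * Y z - α ≤ 0) ∧ (∀ z ∈ B, 0 ≤ X z + β * Y z - α) ∧
      (∀ z ∈ interior A, X z + β * Y z - α < 0) ∧ (∀ z ∈ interior B, 0 < X z + β * Y z - α) ∧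
      ∀ z, dirProj η z = c → X z + β * Y z = α := by
  obtain ⟨η, c, h1, h2, h3, h4⟩ := exists_inner_tangent hA hB hAB
  have hrot : ∀ z, dirProj η z
      = Real.sin (η - θ) * X z + Real.cos (η - θ) * Y z + Real.cos (η - θ) * h := by
    intro z
    rw [dirProj_rotate θ, hX, hY]; ring
  have h1' := fun z hz => dirProj_lt_of_mem_interior (z := z) h1 hz
  have h2' := fun z hz => lt_dirProj_of_mem_interior (z := z) h2 hz
  have hYi : ∀ K : Set (EuclideanSpace ℝ (Fin 2)), (∀ z ∈ K, Y z ≤ 0) →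
      ∀ z ∈ interior K, Y z < 0 := by
    intro K hK z hz
    have := dirProj_lt_of_mem_interior (K := K) (θ := θ) (c := h)
      (fun z hz => by have := hK z hz; rw [hY] at this; simp only at this; linarith) hz
    rw [hY]; simp only; linarith
  refine ⟨η, c, (c - Real.cos (η - θ) * h) / Real.sin (η - θ),
    Real.cos (η - θ) / Real.sin (η - θ), ⟨Or.inl h1, h3⟩, ⟨Or.inr h2, h4⟩, ?_⟩
  simp only [hrot] at h1 h2 h1' h2' ⊢
  generalize Real.sin (η - θ) = s at *
  generalize Real.cos (η - θ) = t at *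
  have ea := h1 a ha
  have eb := h2 b hb
  rw [haY] at ea
  rw [hbY] at eb
  -- The order of `a` and `b` gives `0 ≤ s`. If `s = 0`, the tangent would be the axis itself, and
  -- the bodies, both below it, could not be separated by it.
  have hs : 0 < s := by
    have hs0 : 0 ≤ s := by
      by_contra! hneg
      nlinarith
    refine hs0.lt_of_ne fun h0 => ?_
    obtain ⟨a₀, ha₀⟩ := hA.interior_nonempty
    obtain ⟨b₀, hb₀⟩ := hB.interior_nonempty
    have i1 := h1' a₀ ha₀
    have i2 := h2' b₀ hb₀
    have i3 := hYi A hAh a₀ ha₀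
    have i4 := hYi B hBh b₀ hb₀
    rw [← h0] at i1 i2 ea eb
    rcases le_total 0 t with ht | ht <;> nlinarith
  have hexp : ∀ z, s * (X z + t / s * Y z - (c - t * h) / s) = s * X z + t * Y z + t * h - c := by
    intro z; field_simp; ring
  refine ⟨fun z hz => ?_, fun z hz => ?_, fun z hz => ?_, fun z hz => ?_, fun z hz => ?_⟩
  · have := hexp z; have := h1 z hz
    by_contra! hcon
    nlinarith
  · have := hexp z; have := h2 z hz
    by_contra! hcon
    nlinarith
  · have := hexp z; have := h1' z hz
    by_contra! hcon
    nlinarith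
  · have := hexp z; have := h2' z hz
    by_contra! hcon
    nlinarith
  · have := hexp z
    rw [hz, sub_self] at this
    linarith [(mul_eq_zero.1 this).resolve_left hs.ne']

/-- Three bodies touching a line from below, in the order `A`, `B`, `C`, have an ordinary line. -/
theorem exists_ordinary_of_common_support {θ h : ℝ} {A B C : Set (EuclideanSpace ℝ (Fin 2))}
    (hA : IsConvexBody A) (hB : IsConvexBody B) (hC : IsConvexBody C)
    (hAB : Disjoint A B) (hAC : Disjoint A C) (hBC : Disjoint B C)
    (hAh : ∀ z ∈ A, dirProj θ z ≤ h) (hBh : ∀ z ∈ B, dirProj θ z ≤ h)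
    (hCh : ∀ z ∈ C, dirProj θ z ≤ h)
    {a b c : EuclideanSpace ℝ (Fin 2)} (ha : a ∈ A) (hb : b ∈ B) (hc : c ∈ C)
    (hah : dirProj θ a = h) (hbh : dirProj θ b = h) (hch : dirProj θ c = h)
    (hab : dirProj (θ + Real.pi / 2) a < dirProj (θ + Real.pi / 2) b)
    (hbc : dirProj (θ + Real.pi / 2) b < dirProj (θ + Real.pi / 2) c) :
    ∃ η e : ℝ, {z | dirProj η z = e ∧ (z ∈ A ∨ z ∈ B ∨ z ∈ C)}.ncard = 2 := by
  by_contra! hno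
  obtain ⟨X, hX⟩ : ∃ X, X = dirProj (θ + Real.pi / 2) := ⟨_, rfl⟩
  obtain ⟨Y, hY⟩ : ∃ Y, Y = fun z => dirProj θ z - h := ⟨_, rfl⟩
  have hYz : ∀ z, dirProj θ z = Y z + h := fun z => by rw [hY]; ring
  have hne : ∀ {K M : Set (EuclideanSpace ℝ (Fin 2))}, Disjoint K M → ∀ {x y}, x ∈ K → y ∈ M →
      ¬ (X x = X y ∧ Y x = Y y) := by
    rintro K M hKM x y hx hy ⟨h1, h2⟩
    have : x = y := eq_of_dirProj_eq (θ := θ) (by rw [hX] at h1; exact h1)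
      (by rw [hYz, hYz, h2])
    exact Set.disjoint_left.1 hKM hx (this ▸ hy)
  simp only [← hX, hYz] at hab hbc hAh hBh hCh hah hbh hch
  replace hAh : ∀ z ∈ A, Y z ≤ 0 := fun z hz => by linarith [hAh z hz]
  replace hCh : ∀ z ∈ C, Y z ≤ 0 := fun z hz => by linarith [hCh z hz]
  have hBi : ∀ z ∈ interior B, Y z < 0 := fun z hz => by
    have := dirProj_lt_of_mem_interior (K := B) (θ := θ) (c := h)
      (fun z hz => by rw [hYz]; exact hBh z hz) hz
    rw [hYz] at this; linarith
  replace hBh : ∀ z ∈ B, Y z ≤ 0 := fun z hz => by linarith [hBh z hz]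
  replace hah : Y a = 0 := by linarith
  replace hbh : Y b = 0 := by linarith
  replace hch : Y c = 0 := by linarith
  obtain ⟨η₁, c₁, α, β, tA, tB, f1, f2, f3, f4, f5⟩ :=
    exists_inner_tangent_normalized hX hY hA hB hAB hAh hBh ha hb hah hbh hab
  obtain ⟨η₂, c₂, γ, δ, tB', tC, g1, g2, g3, g4, g5⟩ :=
    exists_inner_tangent_normalized hX hY hB hC hBC hBh hCh hb hc hbh hch hbc
  obtain ⟨q, hq, hqf⟩ : ∃ q ∈ C, dirProj η₁ q = c₁ := by
    by_contra! hcon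
    exact hno η₁ c₁ (ncard_eq_two_of_touchesLine hA.strictConvex hB.strictConvex hAB tA tB hcon)
  obtain ⟨p, hp, hpg⟩ : ∃ p ∈ A, dirProj η₂ p = c₂ := by
    by_contra! hcon
    apply hno η₂ c₂
    have := ncard_eq_two_of_touchesLine hB.strictConvex hC.strictConvex hBC tB' tC hcon
    convert this using 2
    ext z
    simp only [Set.mem_ofPred_eq]
    tauto
  replace hqf := f5 q hqf
  replace hpg := g5 p hpg
  -- The excluded direction is that of the common supporting line, the one half-plane in which `z`
  -- could lie on the boundary.
  obtain ⟨η, hη, hηθ⟩ := exists_outer_tangent_ne hA hC hAC θ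
  have tA'' := touchesLine_angleSupport hA η
  have tC'' := touchesLine_angleSupport hC η
  obtain ⟨z, hz, hzk⟩ : ∃ z ∈ B, dirProj η z = angleSupport A η := by
    by_contra! hcon
    apply hno η (angleSupport A η)
    have := ncard_eq_two_of_touchesLine hA.strictConvex hC.strictConvex hAC tA''
      (hη ▸ tC'') hcon
    convert this using 2
    ext z
    simp only [Set.mem_ofPred_eq]
    tauto
  obtain ⟨a₀, ha₀⟩ := hA.interior_nonempty
  obtain ⟨b₀, hb₀⟩ := hB.interior_nonempty
  obtain ⟨c₀, hc₀⟩ := hC.interior_nonempty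
  have hkA := fun z hz => dirProj_le_angleSupport hA.isCompact η (z := z) hz
  have hkC := fun z hz => dirProj_le_angleSupport hC.isCompact η (z := z) hz
  rw [← hη] at hkC
  have hrot : ∀ z, dirProj η z
      = Real.sin (η - θ) * X z + Real.cos (η - θ) * Y z + Real.cos (η - θ) * h := by
    intro z
    rw [dirProj_rotate θ, hX, hY]; ring
  simp only [hrot] at hkA hkC hzk
  generalize angleSupport A η = m at *
  have fa := f1 a ha
  have fb := f2 b hb
  have gb := g1 b hb
  have gc := g2 c hc
  have ka := hkA a ha
  have kc := hkC c hc
  rw [hah] at fa ka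
  rw [hbh] at fb gb
  rw [hch] at gc kc
  have nqb := hne hBC.symm hq hb
  have npb := hne hAB hp hb
  have nza := hne hAB.symm hz ha
  have nzc := hne hBC hz hc
  rw [hbh] at nqb npb
  rw [hah] at nza
  rw [hch] at nzc
  have := middle_point_lt (m := m - Real.cos (η - θ) * h) (by linarith) (by linarith)
    (by linarith) (by linarith)
    (hBi b₀ hb₀) (f4 b₀ hb₀) (g3 b₀ hb₀) (f3 a₀ ha₀) (g4 c₀ hc₀) hqf (g2 q hq) (hCh q hq) nqb
    hpg (f1 p hp) (hAh p hp) npb (hBh z hz) (f2 z hz) (g1 z hz) (hne hAB.symm hz hp)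
    (hne hBC hz hq) nza nzc (by linarith) (by linarith)
    (by linarith [hkA p hp]) (by linarith [hkC q hq])
    (by linarith [hkA a₀ (interior_subset ha₀)])
    (by linarith [hkC c₀ (interior_subset hc₀)]) hηθ
  linarith

/-! ### Ordinary lines for two and three bodies. -/

/-- The case in which the support functions of `A` and `B` agree and dominate. -/
theorem exists_ordinary_of_support_eq {θ : ℝ} {A B C : Set (EuclideanSpace ℝ (Fin 2))}
    (hA : IsConvexBody A) (hB : IsConvexBody B) (hC : IsConvexBody C)
    (hAB : Disjoint A B) (hAC : Disjoint A C) (hBC : Disjoint B C)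
    (h1 : angleSupport A θ = angleSupport B θ) (h2 : angleSupport C θ ≤ angleSupport A θ) :
    ∃ η e : ℝ, {z | dirProj η z = e ∧ (z ∈ A ∨ z ∈ B ∨ z ∈ C)}.ncard = 2 := by
  have tA := touchesLine_angleSupport hA θ
  have tB := touchesLine_angleSupport hB θ
  have lA := fun z hz => dirProj_le_angleSupport hA.isCompact θ (z := z) hz
  have lB := fun z hz => dirProj_le_angleSupport hB.isCompact θ (z := z) hz
  have lC := fun z hz => dirProj_le_angleSupport hC.isCompact θ (z := z) hz
  rcases h2.lt_or_eq with h2 | h2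
  · exact ⟨θ, _, ncard_eq_two_of_touchesLine hA.strictConvex hB.strictConvex hAB tA
      (h1 ▸ tB) fun z hz => ((lC z hz).trans_lt h2).ne⟩
  obtain ⟨a, ha, ha'⟩ := exists_dirProj_eq_angleSupport hA θ
  obtain ⟨b, hb, hb'⟩ := exists_dirProj_eq_angleSupport hB θ
  obtain ⟨c, hc, hc'⟩ := exists_dirProj_eq_angleSupport hC θ
  rw [← h1] at lB hb'
  rw [h2] at lC hc'
  generalize angleSupport A θ = h at *
  have hne : ∀ {K M : Set (EuclideanSpace ℝ (Fin 2))}, Disjoint K M → ∀ {x y}, x ∈ K → y ∈ M →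
      dirProj θ x = h → dirProj θ y = h →
      dirProj (θ + Real.pi / 2) x ≠ dirProj (θ + Real.pi / 2) y := by
    intro K M hKM x y hx hy hxh hyh hxy
    exact Set.disjoint_left.1 hKM hx (eq_of_dirProj_eq hxy (hxh.trans hyh.symm) ▸ hy)
  rcases lt_or_gt_of_ne (hne hAB ha hb ha' hb') with o1 | o1 <;>
  rcases lt_or_gt_of_ne (hne hAC ha hc ha' hc') with o2 | o2 <;>
  rcases lt_or_gt_of_ne (hne hBC hb hc hb' hc') with o3 | o3
  · exact exists_ordinary_of_common_support hA hB hC hAB hAC hBC lA lB lC ha hb hc ha' hb' hc' o1 o3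
  · have := exists_ordinary_of_common_support hA hC hB hAC hAB hBC.symm lA lC lB ha hc hb
      ha' hc' hb' o2 o3
    simpa only [or_comm (a := _ ∈ C)] using this
  · linarith
  · have := exists_ordinary_of_common_support hC hA hB hAC.symm hBC.symm hAB lC lA lB hc ha hb
      hc' ha' hb' o2 o1
    simpa only [or_comm (a := _ ∈ C), or_assoc] using this
  · have := exists_ordinary_of_common_support hB hA hC hAB.symm hBC hAC lB lA lC hb ha hc
      hb' ha' hc' o1 o2
    simpa only [or_left_comm (a := _ ∈ B)] using this
  · linarith
  · have := exists_ordinary_of_common_support hB hC hA hBC hAB.symm hAC.symm lB lC lA hb hc ha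
      hb' hc' ha' o3 o2
    simpa only [or_comm (b := _ ∈ A), or_assoc, ← or_assoc (a := _ ∈ B)] using this
  · have := exists_ordinary_of_common_support hC hB hA hBC.symm hAC.symm hAB.symm lC lB lA hc hb ha
      hc' hb' ha' o3 o1
    refine this.imp fun η => Exists.imp fun e he => ?_
    convert he using 2
    ext z
    simp only [Set.mem_ofPred_eq]
    tauto

theorem exists_ordinary_of_three {A B C : Set (EuclideanSpace ℝ (Fin 2))}
    (hA : IsConvexBody A) (hB : IsConvexBody B) (hC : IsConvexBody C)
    (hAB : Disjoint A B) (hAC : Disjoint A C) (hBC : Disjoint B C) :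
    ∃ η e : ℝ, {z | dirProj η z = e ∧ (z ∈ A ∨ z ∈ B ∨ z ∈ C)}.ncard = 2 := by
  -- If no two of the support functions agree where they are maximal, then each of them is
  -- everywhere dominated by another one.
  have dom : ∀ {K M N : Set (EuclideanSpace ℝ (Fin 2))}, IsConvexBody K → IsConvexBody M →
      IsConvexBody N → Disjoint K M →
      (∃ θ, max (angleSupport M θ) (angleSupport N θ) = angleSupport K θ) ∨
      ∀ θ, angleSupport K θ < max (angleSupport M θ) (angleSupport N θ) := by
    intro K M N hK hM hN hKM
    by_contra! hcon
    obtain ⟨hz, θ, hθ⟩ := hcon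
    -- At an angle separating `K` from `M` the support function of `K` is the smaller, so it is not
    -- maximal everywhere and the intermediate value theorem applies.
    obtain ⟨θ₀, h₀⟩ := exists_separating_angleSupport hK hM hKM
    have h₀' : angleSupport K θ₀ < max (angleSupport M θ₀) (angleSupport N θ₀) :=
      lt_max_of_lt_left (h₀.trans (neg_angleSupport_lt hM θ₀))
    have cK := continuous_angleSupport hK.isCompact
    have cM := continuous_angleSupport hM.isCompact
    have cN := continuous_angleSupport hN.isCompact
    have hc : Continuous fun θ => max (angleSupport M θ) (angleSupport N θ) - angleSupport K θ := by
      fun_prop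
    obtain ⟨θ', hθ'⟩ := mem_range_of_exists_le_of_exists_ge hc ⟨θ, sub_nonpos.2 hθ⟩
      ⟨θ₀, (sub_pos.2 h₀').le⟩
    exact hz θ' (sub_eq_zero.1 hθ')
  rcases dom hA hB hC hAB with ⟨θ, h⟩ | h1
  · rcases max_choice (angleSupport B θ) (angleSupport C θ) with h' | h'
    · exact exists_ordinary_of_support_eq hA hB hC hAB hAC hBC (θ := θ) (by rw [← h, h'])
        (by rw [← h]; exact le_max_right _ _)
    · have := exists_ordinary_of_support_eq hA hC hB hAC hAB hBC.symm (θ := θ) (by rw [← h, h'])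
        (by rw [← h]; exact le_max_left _ _)
      simpa only [or_comm (a := _ ∈ C)] using this
  rcases dom hB hA hC hAB.symm with ⟨θ, h⟩ | h2
  · have hA' := h1 θ
    have : angleSupport C θ = angleSupport B θ := by grind
    have := exists_ordinary_of_support_eq hB hC hA hBC hAB.symm hAC.symm (θ := θ) this.symm
      (by rw [← h]; exact le_max_left _ _)
    refine this.imp fun η => Exists.imp fun e he => ?_
    convert he using 2
    ext z
    simp only [Set.mem_ofPred_eq]
    tauto
  rcases dom hC hA hB hAC.symm with ⟨θ, h⟩ | h3
  · have hA' := h1 θ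
    have hB' := h2 θ
    grind
  · have hA' := h1 0
    have hB' := h2 0
    have hC' := h3 0
    grind

theorem exists_ordinary_of_two {A B : Set (EuclideanSpace ℝ (Fin 2))}
    (hA : IsConvexBody A) (hB : IsConvexBody B) (hAB : Disjoint A B) :
    ∃ η e : ℝ, {z | dirProj η z = e ∧ (z ∈ A ∨ z ∈ B)}.ncard = 2 := by
  obtain ⟨η, e, h1, h2, h3, h4⟩ := exists_inner_tangent hA hB hAB
  have := ncard_eq_two_of_touchesLine hA.strictConvex hB.strictConvex hAB
    (C := ∅) ⟨Or.inl h1, h3⟩ ⟨Or.inr h2, h4⟩ (by simp)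
  exact ⟨η, e, by simpa using this⟩

/-! ### Lines as affine subspaces, and the conclusion. -/

/-- The line with equation `dirProj θ z = c`. -/
noncomputable def dirLine (θ c : ℝ) : AffineSubspace ℝ (EuclideanSpace ℝ (Fin 2)) :=
  AffineSubspace.mk' !₂[c * Real.cos θ, c * Real.sin θ] (ℝ ∙ !₂[-Real.sin θ, Real.cos θ])

theorem mem_dirLine {θ c : ℝ} {z : EuclideanSpace ℝ (Fin 2)} :
    z ∈ dirLine θ c ↔ dirProj θ z = c := by
  have hsc := Real.sin_sq_add_cos_sq θ
  rw [dirLine, AffineSubspace.mem_mk', Submodule.mem_span_singleton, dirProj]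
  constructor
  · rintro ⟨t, ht⟩
    have h0 := congrArg (fun z : EuclideanSpace ℝ (Fin 2) => z 0) ht
    have h1 := congrArg (fun z : EuclideanSpace ℝ (Fin 2) => z 1) ht
    simp at h0 h1
    linear_combination (-Real.cos θ) * h0 - Real.sin θ * h1 + c * hsc
  · intro h
    refine ⟨Real.cos θ * z 1 - Real.sin θ * z 0, EuclideanSpace.ext_fin_two ?_ ?_⟩
    · simp
      linear_combination z 0 * hsc - Real.cos θ * h
    · simp
      linear_combination z 1 * hsc - Real.sin θ * h

theorem isLine_dirLine (θ c : ℝ) : IsLine (dirLine θ c) := by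
  rw [IsLine, dirLine, AffineSubspace.direction_mk']
  apply finrank_span_singleton
  intro h
  have h0 := congrArg (fun z : EuclideanSpace ℝ (Fin 2) => z 0) h
  have h1 := congrArg (fun z : EuclideanSpace ℝ (Fin 2) => z 1) h
  simp at h0 h1
  have := Real.sin_sq_add_cos_sq θ
  rw [h0, h1] at this
  norm_num at this

theorem IsConvexSystem.isConvexBody {n : ℕ} {K : Fin n → Set (EuclideanSpace ℝ (Fin 2))}
    (hK : IsConvexSystem K) (i : Fin n) : IsConvexBody (K i) :=
  ⟨hK.isCompact i, hK.strictConvex i, hK.interior_nonempty i⟩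

theorem isOrdinaryLine_dirLine {n : ℕ} {K : Fin n → Set (EuclideanSpace ℝ (Fin 2))} {θ c : ℝ}
    (h : {z | dirProj θ z = c ∧ ∃ i, z ∈ K i}.ncard = 2) : IsOrdinaryLine K (dirLine θ c) := by
  refine ⟨isLine_dirLine θ c, ?_⟩
  convert h using 2
  ext z
  simp [mem_dirLine]

theorem IsConvexSystem.exists_isOrdinaryLine {n : ℕ} (hn : n ≤ 3)
    {K : Fin n → Set (EuclideanSpace ℝ (Fin 2))} (hK : IsConvexSystem K) :
    ∃ L, IsOrdinaryLine K L := by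
  have h2 := hK.two_le_card
  have hb := hK.isConvexBody
  have hd := hK.disjoint
  obtain rfl | rfl : n = 2 ∨ n = 3 := by omega
  · obtain ⟨θ, c, h⟩ := exists_ordinary_of_two (hb 0) (hb 1) (hd 0 1 (by decide))
    exact ⟨dirLine θ c, isOrdinaryLine_dirLine (by simpa [Fin.exists_fin_two] using h)⟩
  · obtain ⟨θ, c, h⟩ := exists_ordinary_of_three (hb 0) (hb 1) (hb 2) (hd 0 1 (by decide))
      (hd 0 2 (by decide)) (hd 1 2 (by decide))
    exact ⟨dirLine θ c, isOrdinaryLine_dirLine (by simpa [Fin.exists_fin_succ] using h)⟩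

theorem theorem3p1 (n : ℕ) :
    (∃ K : Fin n → Set (EuclideanSpace ℝ (Fin 2)),
      IsConvexSystem K ∧ ¬ ∃ L : AffineSubspace ℝ (EuclideanSpace ℝ (Fin 2)), IsOrdinaryLine K L) ↔
    n > 3 := by
  constructor
  · rintro ⟨K, hK, hL⟩
    by_contra! hn
    exact hL (hK.exists_isOrdinaryLine hn)
  · intro hn
    exact ⟨discSystem n, isConvexSystem_discSystem (by omega),
      fun ⟨L, hL⟩ => not_isOrdinaryLine_discSystem hn L hL⟩
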